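/- All sets are standard Borel spaces. Let $N$ be a finite set of agents, $\Theta=\prod_{i\in N}\Theta^i$ the space of type profiles and $O$ the set of outcomes. A stochastic mapping $g:X\to\Delta(Y)$ is a Markov kernel; its average against a probability measure $\mu\in\Delta(X)$ is $g_\mu(E)=\int_X g(x)(E)\,\mu(dx)$, the compound of $h:X\to\Delta(Y)$ and $g:Y\to\Delta(Z)$ is $(g\circ h)(x)=g_{h(x)}$, and a profile $h^i:X^i\to\Delta(Y^i)$ is identified with its joint function $x\mapsto\bigotimes_{i} h^i(x^i)$. A Borel map $f$ is identified with the stochastic mapping $x\mapsto 1_{f(x)}$ (Dirac measure). Write $g\sim h$ (kernel equivalence) for $g:X\to\Delta(Y)$, $h:X\to\Delta(Z)$ if for all $\mu_0\in\Delta(X)$ we have $\{\mu\in\Delta(X):g_\mu=g_{\mu_0}\}=\{\mu\in\Delta(X):h_\mu=h_{\mu_0}\}$; $g$ is Blackwell more informative than $h$ if $h=b\circ g$ for some stochastic mapping $b:Y\to\Delta(Z)$. An augmented mechanism $(\mathcal M,\sigma)$ consists of message spaces $M^i$ ($i\in N$), with $M=\prod_i M^i$, an outcome function $\omega:M\to\Delta(O)$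 and strategies $\sigma^i:\Theta^i\to\Delta(M^i)$; it is deterministic if $\omega$ is a Borel map $M\to O$ and each $\sigma^i$ is a Borel map $\Theta^i\to M^i$. A fictitious direct mechanism $(\mathcal D,\varphi)$ consists of an outcome function $\delta:\Theta\to\Delta(O)$ and a filter, i.e. a profile $\varphi^i:\Theta^i\to\Delta(\Theta^i)$ such that $\varphi$ is Blackwell more informative than $\delta$; it is deterministic if $\delta$ is a Borel map $\Theta\to O$ and each $\varphi^i$ is a Borel map $\Theta^i\to\Theta^i$. If $\omega\circ\sigma=\delta$ and $\sigma\sim\varphi$, we say that $(\mathcal D,\varphi)$ is implemented by $(\mathcal M,\sigma)$ and that $(\mathcal M,\sigma)$ is represented by $(\mathcal D,\varphi)$. **Theorem.** Every deterministic fictitious direct mechanism is implemented by a deterministic augmented mechanism. Conversely, every deterministic augmented mechanism $(\mathcal M,\sigma)$ is represented by a deterministic fictitious direct mechanism $(\mathcal D,\varphi)$. Its filter, a profile of Borel maps $\varphi^i:\Theta^i\to\Theta^i$, can moreover be taken such that, for every agent $i$ for whom there is a Borel map selecting one point in each fiber of $\sigma^i$, the map $\varphi^i$ is such a selector: $\sigma^i(\varphi^i(\theta^i))=\sigma^i(\theta^i)$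 for all $\theta^i$, and $\varphi^i(\theta^i)=\varphi^i(\tilde\theta^i)$ if and only if $\sigma^i(\theta^i)=\sigma^i(\tilde\theta^i)$. -/

import Mathlib

open MeasureTheory ProbabilityTheory

universe uN u v w

namespace FictitiousRevelation

noncomputable section

/-! ### Stochastic mappings

A stochastic mapping `X → Δ(Y)` is a Markov kernel from `X` to `Y`. Its average against `μ` is
Mathlib's `g ∘ₘ μ`, the compound of two stochastic mappings is Mathlib's `g ∘ₖ h`, and a measurable
function regarded as a stochastic mapping is Mathlib's `Kernel.deterministic`. -/

/-- The joint function of a profile of stochastic mappings: `x ↦ ⨂ i, h i (x i)`. -/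
def joint {N : Type uN} [Fintype N] {X : N → Type u} {Y : N → Type w}
    [∀ i, MeasurableSpace (X i)] [∀ i, MeasurableSpace (Y i)]
    (h : ∀ i, Kernel (X i) (Y i)) [∀ i, IsMarkovKernel (h i)] :
    Kernel (∀ i, X i) (∀ i, Y i) where
  toFun x := Measure.pi fun i => h i (x i)
  measurable' := by
    refine Measurable.measure_of_isPiSystem_of_isProbabilityMeasure
      generateFrom_pi.symm isPiSystem_pi ?_
    rintro _ ⟨t, ht, rfl⟩
    simp only [Measure.pi_pi]
    exact Finset.measurable_prod _ fun i _ =>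
      ((h i).measurable_coe (ht i (Set.mem_univ i))).comp (measurable_pi_apply i)

instance {N : Type uN} [Fintype N] {X : N → Type u} {Y : N → Type w}
    [∀ i, MeasurableSpace (X i)] [∀ i, MeasurableSpace (Y i)]
    (h : ∀ i, Kernel (X i) (Y i)) [∀ i, IsMarkovKernel (h i)] :
    IsMarkovKernel (joint h) :=
  ⟨fun x => (inferInstance : IsProbabilityMeasure (Measure.pi fun i => h i (x i)))⟩

section Orders

variable {X Y Z : Type*} [MeasurableSpace X] [MeasurableSpace Y] [MeasurableSpace Z]

/-- The feasible priors: the probability measures that are observationally indistinguishable from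
`μ₀` through `g`. -/
def feasiblePriors (g : Kernel X Y) (μ₀ : ProbabilityMeasure X) : Set (ProbabilityMeasure X) :=
  {μ | g ∘ₘ (μ : Measure X) = g ∘ₘ (μ₀ : Measure X)}

/-- `g` is kernel more informative than `h`. -/
def KernelMoreInformative (g : Kernel X Y) (h : Kernel X Z) : Prop :=
  ∀ μ₀ : ProbabilityMeasure X, feasiblePriors g μ₀ ⊆ feasiblePriors h μ₀

/-- `g` and `h` are kernel equivalent. -/
def KernelEquivalent (g : Kernel X Y) (h : Kernel X Z) : Prop :=
  KernelMoreInformative g h ∧ KernelMoreInformative h g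

/-- `g` is Blackwell more informative than `h`: `h` is a garbling of `g`. -/
def BlackwellMoreInformative (g : Kernel X Y) (h : Kernel X Z) : Prop :=
  ∃ b : Kernel Y Z, IsMarkovKernel b ∧ h = b ∘ₖ g

/-- The stochastic mapping `g` is (the one given by) a measurable function. -/
def IsDeterministicKernel (g : Kernel X Y) : Prop :=
  ∃ (f : X → Y) (hf : Measurable f), g = Kernel.deterministic f hf

/-- `p` is a Borel map that selects one point in each fiber of `s`. -/
structure IsFiberSelector (s : X → Y) (p : X → X) : Prop where
  measurable : Measurable p
  mem_fiber : ∀ x, s (p x) = s x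
  eq_iff : ∀ x x', p x = p x' ↔ s x = s x'

end Orders

/-- An augmented mechanism: standard Borel message spaces `Msg i`, a stochastic outcome function
on message profiles, and a strategy for each agent. -/
structure AugmentedMechanism {N : Type uN} [Fintype N] (Θ : N → Type u)
    [∀ i, MeasurableSpace (Θ i)] (O : Type v) [MeasurableSpace O] where
  Msg : N → Type w
  [measurableSpace_msg : ∀ i, MeasurableSpace (Msg i)]
  [standardBorel_msg : ∀ i, StandardBorelSpace (Msg i)]
  outcome : Kernel (∀ i, Msg i) O
  [markov_outcome : IsMarkovKernel outcome]
  strategy : ∀ i, Kernel (Θ i) (Msg i)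
  [markov_strategy : ∀ i, IsMarkovKernel (strategy i)]

attribute [instance] AugmentedMechanism.measurableSpace_msg AugmentedMechanism.standardBorel_msg
  AugmentedMechanism.markov_outcome AugmentedMechanism.markov_strategy

/-- A fictitious direct mechanism: a stochastic outcome function on type profiles, with a filter,
i.e. a profile of stochastic mappings `Θ i → Δ(Θ i)` whose joint function is Blackwell more
informative than the outcome function. -/
structure FictitiousDirectMechanism {N : Type uN} [Fintype N] (Θ : N → Type u)
    [∀ i, MeasurableSpace (Θ i)] (O : Type v) [MeasurableSpace O] where
  outcome : Kernel (∀ i, Θ i) O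
  [markov_outcome : IsMarkovKernel outcome]
  filter : ∀ i, Kernel (Θ i) (Θ i)
  [markov_filter : ∀ i, IsMarkovKernel (filter i)]
  blackwell : BlackwellMoreInformative (joint filter) outcome

attribute [instance] FictitiousDirectMechanism.markov_outcome
  FictitiousDirectMechanism.markov_filter

section Mechanisms

variable {N : Type uN} [Fintype N] {Θ : N → Type u} [∀ i, MeasurableSpace (Θ i)]
  {O : Type v} [MeasurableSpace O]

/-- The outcome function is a Borel map `M → O` and the strategies are pure. -/
def AugmentedMechanism.IsDeterministic (A : AugmentedMechanism.{uN, u, v, w} Θ O) : Prop :=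
  IsDeterministicKernel A.outcome ∧ ∀ i, IsDeterministicKernel (A.strategy i)

/-- The outcome function is a Borel map `Θ → O` and the filter consists of Borel maps
`Θ i → Θ i`. -/
def FictitiousDirectMechanism.IsDeterministic (D : FictitiousDirectMechanism Θ O) : Prop :=
  IsDeterministicKernel D.outcome ∧ ∀ i, IsDeterministicKernel (D.filter i)

/-- The two mechanisms are equivalent: `D` is implemented by `A`, and `A` is represented by `D`. -/
def Equivalent (A : AugmentedMechanism.{uN, u, v, w} Θ O) (D : FictitiousDirectMechanism Θ O) :
    Prop :=
  A.outcome ∘ₖ joint A.strategy = D.outcome ∧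
    KernelEquivalent (joint A.strategy) (joint D.filter)

end Mechanisms

end

end FictitiousRevelation

/-! For deterministic kernels the informational relations reduce to Borel factorization: two Borel
maps that factor through each other by Borel maps are garblings of each other, hence kernel
equivalent. To implement, the filter itself serves as strategy profile. The garbling yielding the
outcome may be stochastic, but it is Dirac on the range of the filter, so
`exists_measurable_of_eq_dirac` replaces it by a Borel map. To represent,
`exists_equivalent_selfMap` turns each strategy into a self-map of the type space: a fiber selector
if one exists. Otherwise the type space is uncountable, so the message space embeds in it. -/

namespace FictitiousRevelation

section Kernels

variable {X Y Z : Type*} [MeasurableSpace X] [MeasurableSpace Y] [MeasurableSpace Z]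

theorem deterministic_inj [MeasurableSpace.SeparatesPoints Y] {f g : X → Y} {hf : Measurable f}
    {hg : Measurable g} (h : Kernel.deterministic f hf = Kernel.deterministic g hg) : f = g := by
  ext x
  have hx := DFunLike.congr_fun h x
  rw [Kernel.deterministic_apply, Kernel.deterministic_apply] at hx
  exact (dirac_eq_dirac_iff).1 hx

theorem BlackwellMoreInformative.kernelMoreInformative {g : Kernel X Y} {h : Kernel X Z}
    (H : BlackwellMoreInformative g h) : KernelMoreInformative g h := by
  obtain ⟨b, -, rfl⟩ := H
  intro μ₀ μ hμ
  simp only [feasiblePriors, Set.mem_ofPred_eq] at hμ ⊢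
  rw [← Measure.comp_assoc, hμ, Measure.comp_assoc]

theorem blackwellMoreInformative_deterministic {f : X → Y} {g : X → Z} {r : Y → Z}
    (hf : Measurable f) (hg : Measurable g) (hr : Measurable r) (h : ∀ x, g x = r (f x)) :
    BlackwellMoreInformative (Kernel.deterministic f hf) (Kernel.deterministic g hg) := by
  refine ⟨Kernel.deterministic r hr, inferInstance, ?_⟩
  rw [Kernel.deterministic_comp_deterministic]
  congr 1
  exact funext h

/-- Wherever a stochastic mapping takes a Dirac value, a single measurable function reads it off. -/
theorem exists_measurable_of_eq_dirac [Nonempty Z] [StandardBorelSpace Z] (b : Kernel Y Z) :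
    ∃ c : Y → Z, Measurable c ∧ ∀ y z, b y = Measure.dirac z → c y = z := by
  have he := measurableEmbedding_embeddingReal Z
  obtain ⟨q, hq, hqe⟩ := he.exists_measurable_extend measurable_id fun _ => ‹Nonempty Z›
  -- The mean of the embedded variable is measurable in `y`, and at a Dirac value it is the embedded
  -- point, which `q` decodes.
  refine ⟨fun y => q (∫ z, embeddingReal Z z ∂(b y)),
    hq.comp (he.measurable.stronglyMeasurable.integral_kernel).measurable, fun y z h => ?_⟩
  simp only [h, integral_dirac]
  exact congrFun hqe z

end Kernels

theorem measurable_piMap {N : Type*} {X : N → Type*} {Y : N → Type*}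
    [∀ i, MeasurableSpace (X i)] [∀ i, MeasurableSpace (Y i)] {f : ∀ i, X i → Y i}
    (hf : ∀ i, Measurable (f i)) : Measurable fun (x : ∀ i, X i) i => f i (x i) :=
  measurable_pi_lambda _ fun i => (hf i).comp (measurable_pi_apply (X := X) i)

theorem joint_deterministic {N : Type uN} [Fintype N] {X : N → Type u} {Y : N → Type w}
    [∀ i, MeasurableSpace (X i)] [∀ i, MeasurableSpace (Y i)]
    (h : ∀ i, Kernel (X i) (Y i)) [∀ i, IsMarkovKernel (h i)] (f : ∀ i, X i → Y i)
    (hf : ∀ i, Measurable (f i)) (hh : ∀ i, h i = Kernel.deterministic (f i) (hf i)) :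
    joint h = Kernel.deterministic (fun x i => f i (x i)) (measurable_piMap hf) := by
  ext1 x
  rw [Kernel.deterministic_apply]
  change Measure.pi (fun i => h i (x i)) = _
  simp only [hh, Kernel.deterministic_apply]
  refine Measure.pi_eq fun t ht => ?_
  rw [Measure.dirac_apply' _ (MeasurableSet.univ_pi ht)]
  simp only [Measure.dirac_apply' _ (ht _)]
  classical
  by_cases hx : ∀ i, f i (x i) ∈ t i
  · simp [Set.indicator, hx]
  · obtain ⟨i, hi⟩ := not_forall.1 hx
    rw [Finset.prod_eq_zero (Finset.mem_univ i) (by simp [hi])]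
    simp [Set.indicator, hx]

theorem exists_isFiberSelector_of_countable {X Y : Type*} [MeasurableSpace X]
    [MeasurableSingletonClass X] [Countable X] (s : X → Y) :
    ∃ p : X → X, IsFiberSelector s p := by
  have hout : ∀ x, s (Quotient.mk (Setoid.ker s) x).out = s x := fun x =>
    Quotient.mk_out (s := Setoid.ker s) x
  refine ⟨fun x => (Quotient.mk (Setoid.ker s) x).out, measurable_of_countable _, hout,
    fun x x' => ⟨fun h => ?_, fun h => ?_⟩⟩
  · rw [← hout x, ← hout x']
    exact congrArg s h
  · exact congrArg Quotient.out (Quotient.sound (s := Setoid.ker s) h)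

section Selectors

variable {X : Type u} {Y : Type w} [MeasurableSpace X] [MeasurableSpace Y] [StandardBorelSpace X]
  [StandardBorelSpace Y]

/-- A fiber selector of a Borel map factors through that map by a Borel map. -/
theorem IsFiberSelector.exists_factor [Nonempty X] {s : X → Y} {p : X → X}
    (hp : IsFiberSelector s p) (hs : Measurable s) :
    ∃ e : Y → X, Measurable e ∧ ∀ x, p x = e (s x) := by
  -- The fixed points of `p` form a Borel transversal of the fibers. By Lusin–Souslin, `s` embeds it
  -- measurably; `e` extends the inverse.
  have hT : MeasurableSet {x | p x = x} := measurableSet_eq_fun hp.measurable measurable_id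
  have := hT.standardBorel
  have hfix : ∀ x, p (p x) = p x := fun x => (hp.eq_iff _ _).2 (hp.mem_fiber x)
  have hemb : MeasurableEmbedding fun x : {x | p x = x} => s x := by
    refine (hs.comp measurable_subtype_coe).measurableEmbedding fun x x' h => ?_
    have h' := (hp.eq_iff _ _).2 h
    rw [x.2, x'.2] at h'
    exact Subtype.ext h'
  obtain ⟨e, he, hes⟩ := hemb.exists_measurable_extend measurable_subtype_coe fun _ => ‹_›
  refine ⟨e, he, fun x => ?_⟩
  have := congrFun hes ⟨p x, hfix x⟩
  simp only [Function.comp_apply, hp.mem_fiber] at this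
  exact this.symm

/-- Uncountable standard Borel spaces are Borel isomorphic to ℝ, where every standard Borel space
embeds. -/
theorem exists_measurableEmbedding_of_not_countable (hX : ¬ Countable X) :
    ∃ e : Y → X, MeasurableEmbedding e :=
  ⟨_, (PolishSpace.measurableEquivOfNotCountable hX
    (not_countable (α := ℝ))).symm.measurableEmbedding.comp (measurableEmbedding_embeddingReal Y)⟩

/-- A Borel map into any standard Borel space is as informative as a Borel self-map of its domain,
which is a fiber selector if there is one. -/
theorem exists_equivalent_selfMap {s : X → Y} (hs : Measurable s) :
    ∃ f : X → X, Measurable f ∧ ((∃ p, IsFiberSelector s p) → IsFiberSelector s f) ∧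
      (∃ r : X → Y, Measurable r ∧ ∀ x, s x = r (f x)) ∧
      (Nonempty X → ∃ e : Y → X, Measurable e ∧ ∀ x, f x = e (s x)) := by
  by_cases h : ∃ p, IsFiberSelector s p
  · obtain ⟨p, hp⟩ := h
    exact ⟨p, hp.measurable, fun _ => hp, ⟨s, hs, fun x => (hp.mem_fiber x).symm⟩,
      fun _ => hp.exists_factor hs⟩
  · have hX : ¬ Countable X := fun _ => h (exists_isFiberSelector_of_countable s)
    obtain ⟨x₀⟩ : Nonempty X := not_isEmpty_iff.1 fun _ => hX inferInstance
    obtain ⟨e, he⟩ := exists_measurableEmbedding_of_not_countable (Y := Y) hX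
    obtain ⟨r, hr, hre⟩ := he.exists_measurable_extend measurable_id fun _ => ⟨s x₀⟩
    exact ⟨e ∘ s, he.measurable.comp hs, fun h' => (h h').elim,
      ⟨r, hr, fun x => (congrFun hre (s x)).symm⟩, fun _ => ⟨e, he.measurable, fun _ => rfl⟩⟩

end Selectors

section Mechanisms

variable {N : Type uN} [Fintype N] {Θ : N → Type u} [∀ i, MeasurableSpace (Θ i)]
  [∀ i, StandardBorelSpace (Θ i)] {O : Type v} [MeasurableSpace O]

theorem FictitiousDirectMechanism.exists_implementation [StandardBorelSpace O]
    (D : FictitiousDirectMechanism Θ O)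
    (hD : D.IsDeterministic) :
    ∃ A : AugmentedMechanism.{uN, u, v, u} Θ O, A.IsDeterministic ∧ Equivalent A D := by
  obtain ⟨⟨d, hd, hdD⟩, hfil⟩ := hD
  choose f hf hfD using hfil
  have hj := joint_deterministic D.filter f hf hfD
  obtain ⟨b, hb, hbD⟩ := D.blackwell
  obtain ⟨c, hc, hcd⟩ : ∃ c : (∀ i, Θ i) → O, Measurable c ∧
      ∀ θ, c (fun i => f i (θ i)) = d θ := by
    -- Without type profiles, `O` may be empty and offer no default value.
    rcases isEmpty_or_nonempty (∀ i, Θ i) with hΘ | ⟨⟨θ₀⟩⟩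
    · exact ⟨d, hd, fun θ => hΘ.elim θ⟩
    · have : Nonempty O := ⟨d θ₀⟩
      obtain ⟨c, hc, hcb⟩ := exists_measurable_of_eq_dirac b
      refine ⟨c, hc, fun θ => hcb _ _ ?_⟩
      have h := DFunLike.congr_fun hbD θ
      rw [hdD, hj, Kernel.comp_deterministic_eq_comap, Kernel.comap_apply,
        Kernel.deterministic_apply] at h
      exact h.symm
  refine ⟨{ Msg := Θ, outcome := Kernel.deterministic c hc, strategy := D.filter },
    ⟨⟨c, hc, rfl⟩, fun i => ⟨f i, hf i, hfD i⟩⟩, ?_, fun _ => subset_rfl, fun _ => subset_rfl⟩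
  change Kernel.deterministic c hc ∘ₖ joint D.filter = D.outcome
  rw [hj, hdD, Kernel.deterministic_comp_deterministic]
  congr 1
  exact funext hcd

theorem AugmentedMechanism.exists_representation (A : AugmentedMechanism.{uN, u, v, w} Θ O)
    (hA : A.IsDeterministic) :
    ∃ D : FictitiousDirectMechanism Θ O, D.IsDeterministic ∧ Equivalent A D ∧
      ∀ (i : N) (s : Θ i → A.Msg i) (hs : Measurable s),
        A.strategy i = Kernel.deterministic s hs → (∃ p : Θ i → Θ i, IsFiberSelector s p) →
        ∃ (p : Θ i → Θ i) (hp : IsFiberSelector s p),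
          D.filter i = Kernel.deterministic p hp.measurable := by
  obtain ⟨⟨ω, hω, hωA⟩, hstr⟩ := hA
  choose s hs hsA using hstr
  have hjs := joint_deterministic A.strategy s hs hsA
  choose f hf hsel hr he using fun i => exists_equivalent_selfMap (hs i)
  choose r hr hrs using hr
  have hjf := joint_deterministic (fun i => Kernel.deterministic (f i) (hf i)) f hf fun _ => rfl
  have hout : A.outcome ∘ₖ joint A.strategy = Kernel.deterministic (fun θ => ω fun i => s i (θ i))
      (hω.comp (measurable_piMap hs)) := by
    rw [hωA, hjs, Kernel.deterministic_comp_deterministic]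
    rfl
  refine ⟨{ outcome := A.outcome ∘ₖ joint A.strategy
            filter := fun i => Kernel.deterministic (f i) (hf i)
            blackwell := ?_ }, ⟨⟨_, _, hout⟩, fun i => ⟨f i, hf i, rfl⟩⟩, ⟨rfl, ?_, ?_⟩, ?_⟩
  · rw [hout, hjf]
    refine blackwellMoreInformative_deterministic _ _ (hω.comp (measurable_piMap hr)) fun θ => ?_
    simp only [Function.comp_apply, ← hrs]
  -- A nonempty message space admits no map into an empty type space; but then there are no priors
  -- to compare.
  · rcases isEmpty_or_nonempty (∀ i, Θ i) with hΘ | ⟨⟨θ₀⟩⟩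
    · intro μ₀
      obtain ⟨θ⟩ := μ₀.nonempty
      exact hΘ.elim θ
    · choose e he hes using fun i => he i ⟨θ₀ i⟩
      change KernelMoreInformative _ (joint fun i => Kernel.deterministic (f i) (hf i))
      rw [hjs, hjf]
      exact (blackwellMoreInformative_deterministic (r := fun x i => e i (x i)) _ _
        (measurable_piMap he)
        fun θ => funext fun i => hes i (θ i)).kernelMoreInformative
  · change KernelMoreInformative (joint fun i => Kernel.deterministic (f i) (hf i)) _
    rw [hjs, hjf]
    exact (blackwellMoreInformative_deterministic (r := fun x i => r i (x i)) _ _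
        (measurable_piMap hr)
      fun θ => funext fun i => hrs i (θ i)).kernelMoreInformative
  · intro i s' hs' hA' hp
    -- Dirac measures separate points, so the kernel determines its Borel map.
    obtain rfl : s i = s' := deterministic_inj ((hsA i).symm.trans hA')
    exact ⟨f i, hsel i hp, rfl⟩

end Mechanisms

end FictitiousRevelation

theorem mainTheorem4 {N : Type uN} [Fintype N]
    (Θ : N → Type u) [∀ i, MeasurableSpace (Θ i)] [∀ i, StandardBorelSpace (Θ i)]
    (O : Type v) [MeasurableSpace O] [StandardBorelSpace O] :
    (∀ D : FictitiousRevelation.FictitiousDirectMechanism Θ O, D.IsDeterministic →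
      ∃ A : FictitiousRevelation.AugmentedMechanism.{uN, u, v, u} Θ O,
        A.IsDeterministic ∧ FictitiousRevelation.Equivalent A D) ∧
    (∀ A : FictitiousRevelation.AugmentedMechanism.{uN, u, v, w} Θ O, A.IsDeterministic →
      ∃ D : FictitiousRevelation.FictitiousDirectMechanism Θ O,
        D.IsDeterministic ∧ FictitiousRevelation.Equivalent A D ∧
        ∀ (i : N) (s : Θ i → A.Msg i) (hs : Measurable s),
          A.strategy i = Kernel.deterministic s hs →
          (∃ p : Θ i → Θ i, FictitiousRevelation.IsFiberSelector s p) →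
          ∃ (p : Θ i → Θ i) (hp : FictitiousRevelation.IsFiberSelector s p),
            D.filter i = Kernel.deterministic p hp.measurable) := 
  ⟨fun D hD => D.exists_implementation hD, fun A hA => A.exists_representation hA⟩
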